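/- Let $n\ge 1$, write $n=8k+r_0$ with $k\ge 0$ and $1\le r_0\le 8$, and set $$d(n)=\begin{cases}16^k,& r_0=1\\ 2\cdot 16^k,& r_0=2\\ 4\cdot 16^k,& r_0\in\{3,4\}\\ 8\cdot 16^k,& r_0\in\{5,6,7,8\}.\end{cases}$$ Let $\mathrm{Cl}(n)$ be the real Clifford algebra of Euclidean $\mathbb R^n$, with relations $v^2=-\|v\|^2$, let $\mathrm{Spin}(n)\subset \mathrm{Cl}(n)$ be the group of products of an even number of unit vectors, and let $Q_+=\{x\in\mathbb R^n:\|x\|=1\}$. For positive definite inner product spaces $E,S$ equip $E\oplus S$ with the form $b\big((u,s),(u',s')\big)=\langle u,u'\rangle-\langle s,s'\rangle$; for $E=\mathbb R^p$ and $\dim S=q$ this is a model of $\mathbb R^{p,q}$. For $r\ge1$ let $\mathrm{Iso}_{[\![r]\!]}(E\oplus S)$ be the space of flags $F=(F^1\subset\dots\subset F^r)$ of totally isotropic subspaces with $\dim F^i=i$, with its usual topology. Flags $F,F'$ in it are transverse if $F^i+(F'^i)^{\perp_b}=E\oplus S$ for all $1\le i\le r$. A transverse $m$-sphere is a subset homeomorphic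 to $\mathbb S^m$ any two distinct points of which are transverse. The full isotropic flags of $\mathbb R^{p,q}$ are those with $r=\min(p,q)$; for $p=q$ the full flag manifold of $\mathrm{SO}_0(p,p)$ is also modelled by $r=p-1$. (1) Let $\eta:\mathrm{Cl}(n)\to\mathrm{End}_{\mathbb R}(S_n)$ be an irreducible real representation, let $g$ be a spin metric on $S_n$ (an inner product for which every $\eta(x)$, $x\in Q_+$, is orthogonal and every $\eta(x)$, $x\in\mathbb R^n$, is skew-adjoint), and let $S_n^+\subset S_n$ be an irreducible $\mathrm{Spin}(n)$-submodule. Then $\dim_{\mathbb R}S_n^+=d(n)$. Moreover, let $p\ge 1$ and $W=\mathbb R^p\oplus(S_n^+,-g)\cong\mathbb R^{p,d(n)}$, let $x_0\in Q_+$, and for $x\in Q_+$ let $\beta(x)=\mathrm{id}_{\mathbb R^p}\oplus\eta(x_0x)|_{S_n^+}$. Then for every $1\le r\le\min(p,d(n))$ and every $F\in\mathrm{Iso}_{[\![r]\!]}(W)$, in particular for every full isotropic flag $F$ of $W$, the map $x\mapsto\beta(x)\cdot F$ is a topological embedding of $Q_+$ into $\mathrm{Iso}_{[\![r]\!]}(W)$,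 and its image $\{\beta(x)\cdot F: x\in Q_+\}$ is a transverse $(n-1)$-sphere. (2) In particular, if $n\ge2$ and $d=d(n)$, then $\mathrm{Iso}_{[\![d-1]\!]}(\mathbb R^{d-1,d})$ contains a transverse $(n-1)$-sphere. -/

import Mathlib

namespace TransverseSpinor

noncomputable section

open CliffordAlgebra

/-! ### Pseudo-Euclidean spaces and isotropic flags -/

section Flags

variable (E S : Type*) [NormedAddCommGroup E] [InnerProductSpace ℝ E]
  [NormedAddCommGroup S] [InnerProductSpace ℝ S]

/-- The space `E ⊕ S`. It carries the indefinite form `form E S`; the Euclidean (direct sum) norm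
of `WithLp 2` serves only to define the topology of the flag manifolds. -/
abbrev Pseudo : Type _ := WithLp 2 (E × S)

/-- The symmetric bilinear form `⟨u, u'⟩ - ⟨s, s'⟩` on `E ⊕ S`, of signature `(dim E, dim S)`. -/
def form : LinearMap.BilinForm ℝ (Pseudo E S) :=
  (innerₗ E).compl₁₂ (WithLp.fstₗ 2 ℝ E S) (WithLp.fstₗ 2 ℝ E S) -
    (innerₗ S).compl₁₂ (WithLp.sndₗ 2 ℝ E S) (WithLp.sndₗ 2 ℝ E S)

/-- The standard `ℝ^{p,q}`. -/
abbrev Rpq (p q : ℕ) : Type := Pseudo (EuclideanSpace ℝ (Fin p)) (EuclideanSpace ℝ (Fin q))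

/-- The isotropic flags `F¹ ⊂ F² ⊂ ⋯ ⊂ Fʳ` of `E ⊕ S`, where `Fⁱ` is totally isotropic of
dimension `i`; `space i` is the member of dimension `i + 1`, for `i = 0, …, r - 1`. -/
@[ext]
structure IsoFlag (r : ℕ) where
  space : Fin r → Submodule ℝ (Pseudo E S)
  finrank_space : ∀ i, Module.finrank ℝ (space i) = (i : ℕ) + 1
  mono : Monotone space
  isotropic : ∀ i, ∀ u ∈ space i, ∀ v ∈ space i, form E S u v = 0

/-- The isotropic flags of `ℝ^{p,q}` with members of all the dimensions `1, …, r`. -/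
abbrev Iso (p q r : ℕ) : Type := IsoFlag (EuclideanSpace ℝ (Fin p)) (EuclideanSpace ℝ (Fin q)) r

variable {E S}

theorem form_apply (u v : Pseudo E S) :
    form E S u v = inner ℝ u.fst v.fst - inner ℝ u.snd v.snd := rfl

namespace IsoFlag

variable {r : ℕ}

instance (F : IsoFlag E S r) (i : Fin r) : FiniteDimensional ℝ (F.space i) :=
  FiniteDimensional.of_finrank_pos (by rw [F.finrank_space i]; omega)

/-- The usual topology of a flag manifold: a subspace is identified with the orthogonal projection
onto it, and a flag with the tuple of its members. -/
instance : TopologicalSpace (IsoFlag E S r) :=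
  TopologicalSpace.induced
    (fun F (i : Fin r) => ((F.space i).starProjection : Pseudo E S →L[ℝ] Pseudo E S))
    inferInstance

/-- Two flags are transverse if `Vᵏ + (Wᵏ)^⊥` is the whole space for all `k`, with `⊥` taken with
respect to the indefinite form. -/
def Transverse (V W : IsoFlag E S r) : Prop :=
  ∀ i, V.space i ⊔ (form E S).orthogonal (W.space i) = ⊤

/-- The action on flags of a linear automorphism that preserves the form. -/
def map (g : Pseudo E S ≃ₗ[ℝ] Pseudo E S) (hg : ∀ u v, form E S (g u) (g v) = form E S u v)
    (F : IsoFlag E S r) : IsoFlag E S r where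
  space i := (F.space i).map (g : Pseudo E S →ₗ[ℝ] Pseudo E S)
  finrank_space i := by rw [LinearEquiv.finrank_map_eq, F.finrank_space]
  mono _ _ h := Submodule.map_mono (F.mono h)
  isotropic i := by
    rintro _ ⟨u, hu, rfl⟩ _ ⟨v, hv, rfl⟩
    exact (hg u v).trans (F.isotropic i u hu v hv)

/-- A transverse `m`-sphere: a subset of the flag manifold that is homeomorphic to the sphere
`𝕊ᵐ` and whose distinct points are pairwise transverse. -/
def IsTransverseSphere (m : ℕ) (Λ : Set (IsoFlag E S r)) : Prop :=
  Nonempty (Λ ≃ₜ Metric.sphere (0 : EuclideanSpace ℝ (Fin (m + 1))) 1) ∧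
    Λ.Pairwise Transverse

end IsoFlag

/-- The inclusion `g ↦ id ⊕ g` of `O(S)` into the linear automorphisms of `E ⊕ S`. -/
def idSum (g : S ≃ₗᵢ[ℝ] S) : Pseudo E S ≃ₗ[ℝ] Pseudo E S :=
  (WithLp.linearEquiv 2 ℝ (E × S)).trans
    (((LinearEquiv.refl ℝ E).prodCongr g.toLinearEquiv).trans
      (WithLp.linearEquiv 2 ℝ (E × S)).symm)

theorem form_idSum (g : S ≃ₗᵢ[ℝ] S) (u v : Pseudo E S) :
    form E S (idSum g u) (idSum g v) = form E S u v := by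
  have h1 : ∀ w : Pseudo E S, (idSum g w).fst = w.fst := fun _ => rfl
  have h2 : ∀ w : Pseudo E S, (idSum g w).snd = g w.snd := fun _ => rfl
  rw [form_apply, form_apply, h1, h1, h2, h2, g.inner_map_map]

end Flags

/-! ### Clifford modules and spinors -/

/-- The Euclidean space `ℝⁿ`. -/
abbrev V (n : ℕ) : Type := EuclideanSpace ℝ (Fin n)

/-- The quadratic form `x ↦ -‖x‖²` on `ℝⁿ`. -/
def negSq (n : ℕ) : QuadraticForm ℝ (V n) := -(LinearMap.BilinMap.toQuadraticMap (innerₗ (V n)))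

theorem negSq_apply (n : ℕ) (x : V n) : negSq n x = -‖x‖ ^ 2 := by
  simp [negSq]

/-- `Cl(n)`: the real algebra generated by `ℝⁿ` with the relations `x² = -‖x‖²`. -/
abbrev Cl (n : ℕ) : Type := CliffordAlgebra (negSq n)

/-- `Spin(n)`, inside `Cl(n)`. -/
abbrev Spin (n : ℕ) : Submonoid (Cl n) := spinGroup (negSq n)

section Modules

variable {n : ℕ} {S : Type*} [NormedAddCommGroup S] [InnerProductSpace ℝ S]

/-- The inner product of `S` is a spin metric for the representation `η` of `Cl(n)`: unit vectors
of `ℝⁿ` act by orthogonal maps, and all vectors of `ℝⁿ` act by skew-adjoint maps. -/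
structure IsSpinMetric (η : Cl n →ₐ[ℝ] Module.End ℝ S) : Prop where
  orthogonal : ∀ x : V n, ‖x‖ = 1 → ∀ u v : S,
    inner ℝ (η (ι (negSq n) x) u) (η (ι (negSq n) x) v) = inner ℝ u v
  skew : ∀ (x : V n) (u v : S),
    inner ℝ (η (ι (negSq n) x) u) v = -inner ℝ u (η (ι (negSq n) x) v)

/-- A representation of the algebra `Cl(n)`, as a representation of its multiplicative monoid
(the invariant subspaces are the same). -/
def clRep (η : Cl n →ₐ[ℝ] Module.End ℝ S) : Representation ℝ (Cl n) S := (η : Cl n →* Module.End ℝ S)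

/-- The restriction of a representation of `Cl(n)` to `Spin(n)`. -/
def spinRep (η : Cl n →ₐ[ℝ] Module.End ℝ S) : Representation ℝ (Spin n) S :=
  (η : Cl n →* Module.End ℝ S).comp (Spin n).subtype

theorem inner_star {η : Cl n →ₐ[ℝ] Module.End ℝ S} (hη : IsSpinMetric η) (a : Cl n) :
    ∀ u v : S, inner ℝ (η a u) v = inner ℝ u (η (star a) v) := by
  induction a using CliffordAlgebra.induction with
  | algebraMap r =>
    intro u v
    rw [CliffordAlgebra.star_algebraMap, AlgHom.commutes, Module.algebraMap_end_apply,
      Module.algebraMap_end_apply, real_inner_smul_left, real_inner_smul_right]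
  | ι x =>
    intro u v
    rw [CliffordAlgebra.star_ι, map_neg, LinearMap.neg_apply, inner_neg_right, hη.skew]
  | mul a b ha hb =>
    intro u v
    rw [star_mul, map_mul, map_mul, Module.End.mul_apply, Module.End.mul_apply, ha, hb]
  | add a b ha hb =>
    intro u v
    rw [star_add, map_add, map_add, LinearMap.add_apply, LinearMap.add_apply, inner_add_left,
      inner_add_right, ha, hb]

/-- With a spin metric, `Spin(n)` acts on every `Spin(n)`-submodule of `S` by isometries. -/
def spinIsometry {η : Cl n →ₐ[ℝ] Module.End ℝ S} (hη : IsSpinMetric η)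
    (Sp : Subrepresentation (spinRep η)) (g : Spin n) : Sp.toSubmodule ≃ₗᵢ[ℝ] Sp.toSubmodule :=
  LinearEquiv.isometryOfInner
    (LinearEquiv.ofLinearMap (Sp.toRepresentation g) (Sp.toRepresentation g⁻¹)
      (by rw [← Module.End.mul_eq_comp, ← map_mul, mul_inv_cancel, map_one]; rfl)
      (by rw [← Module.End.mul_eq_comp, ← map_mul, inv_mul_cancel, map_one]; rfl))
    (fun u v => by
      change inner ℝ (η (g : Cl n) (u : S)) (η (g : Cl n) (v : S)) = inner ℝ (u : S) (v : S)
      rw [inner_star hη, ← Module.End.mul_apply, ← map_mul,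
        spinGroup.star_mul_self_of_mem g.2, map_one, Module.End.one_apply])

end Modules

theorem unit_sq {n : ℕ} (x : Metric.sphere (0 : V n) 1) :
    ι (negSq n) (x : V n) * ι (negSq n) (x : V n) = -1 := by
  have h : ‖(x : V n)‖ = 1 := by simp
  rw [ι_sq_scalar, negSq_apply, h]
  simp

theorem unit_mem_pin {n : ℕ} (x : Metric.sphere (0 : V n) 1) :
    ι (negSq n) (x : V n) ∈ pinGroup (negSq n) := by
  rw [pinGroup.mem_iff]
  refine ⟨⟨⟨ι (negSq n) (x : V n), -ι (negSq n) (x : V n), ?_, ?_⟩, ?_, rfl⟩, ?_⟩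
  · rw [mul_neg, unit_sq, neg_neg]
  · rw [neg_mul, unit_sq, neg_neg]
  · exact Subgroup.subset_closure ⟨x, rfl⟩
  · rw [Unitary.mem_iff, CliffordAlgebra.star_ι, mul_neg, neg_mul, unit_sq, neg_neg]
    exact ⟨rfl, rfl⟩

/-- The map `f(x) = x₀ x` from the unit sphere of `ℝⁿ` to `Spin(n)`. -/
def sphereToSpin {n : ℕ} (x₀ x : Metric.sphere (0 : V n) 1) : Spin n :=
  ⟨ι (negSq n) (x₀ : V n) * ι (negSq n) (x : V n),
    mul_mem (unit_mem_pin x₀) (unit_mem_pin x), ι_mul_ι_mem_evenOdd_zero (negSq n) _ _⟩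

/-- The map `x ↦ β(x) · F`, where `β(x) = id ⊕ (x₀ x)` acts on `ℝᵖ ⊕ S⁺`, the form of `S⁺` being
the negative of the spin metric. -/
def orbitMap {n : ℕ} {S : Type*} [NormedAddCommGroup S] [InnerProductSpace ℝ S]
    {η : Cl n →ₐ[ℝ] Module.End ℝ S} (hη : IsSpinMetric η) (Sp : Subrepresentation (spinRep η))
    (x₀ : Metric.sphere (0 : V n) 1) {p r : ℕ}
    (F : IsoFlag (EuclideanSpace ℝ (Fin p)) Sp.toSubmodule r) (x : Metric.sphere (0 : V n) 1) :
    IsoFlag (EuclideanSpace ℝ (Fin p)) Sp.toSubmodule r :=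
  F.map (idSum (spinIsometry hη Sp (sphereToSpin x₀ x)))
    (form_idSum (spinIsometry hη Sp (sphereToSpin x₀ x)))

/-- `d(n)`: for `n = 8k + r` with `1 ≤ r ≤ 8`, the number `16ᵏ` times `1, 2, 4, 4, 8, 8, 8, 8` for
`r = 1, …, 8`. (The value at `n = 0` is irrelevant.) -/
def d (n : ℕ) : ℕ :=
  (match (n - 1) % 8 + 1 with
    | 1 => 1
    | 2 => 2
    | 3 => 4
    | 4 => 4
    | _ => 8) * 16 ^ ((n - 1) / 8)

end

end TransverseSpinor

namespace TransverseSpinor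

open Module CliffordAlgebra

/-! ### Systems of anticommuting complex structures and involutions -/

section CliffordSystems

/-! The geometry rests on one identity: with a spin metric, `⟨η(x)s, η(y)s⟩ = ⟨x, y⟩‖s‖²`, and the
orthogonal factor `η(x₀)` does not disturb it. An isotropic vector `u = (v, s)` has `‖v‖ = ‖s‖`, so
`b(β(x)u, β(y)u) = (1 - ⟨x, y⟩)‖s‖²`, which for unit vectors `x ≠ y` vanishes only if `u = 0`
(`eq_zero_of_form_eq_zero`). Hence `β(x)Fⁱ` meets the `b`-orthogonal of `β(y)Fⁱ` trivially, and a
dimension count gives transversality. The same computation gives injectivity of the orbit map;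
continuity and compactness of the sphere make it an embedding.

The dimension is pure algebra. For `n = m + 1`, the products `b₀bᵢ` of orthonormal basis vectors are
`m` anticommuting complex structures generating the even part of `Cl(n)`. So it suffices that every
nonzero module over such a system contains an invariant subspace of dimension `d (m + 1)`
(`hasInvariantSubspace_d`): irreducibility then makes it everything. With `p` generators of square
`-1` and `q` of square `1`, this follows from the classical moves `(p, q) → (p+1, q+1)` (dimension
doubles), `(p, q+4) → (p+4, q)` and `(q, 1) → (0, q+1)` (dimension unchanged), starting from real,
complex and quaternionic base cases. Four doublings and one exchange give the factor `16` of Bott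
periodicity.

For the existence statement no spin representation is needed: the maps `x₀ + ∑ xᵢ eᵢ`, for
skew-adjoint `eᵢ` forming a Clifford system, satisfy the same identity. -/

/-- `p` complex structures `e i`, `i < p`, and `q` involutions `f j`, `j < q`, of a real vector
space, any two of which anticommute. -/
structure CliffordSystem {M : Type*} [AddCommGroup M] [Module ℝ M] (p q : ℕ)
    (e f : ℕ → End ℝ M) : Prop where
  e_sq : ∀ i < p, e i * e i = -1
  f_sq : ∀ j < q, f j * f j = 1
  e_anti : ∀ i < p, ∀ j < p, i ≠ j → e i * e j = -(e j * e i)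
  f_anti : ∀ i < q, ∀ j < q, i ≠ j → f i * f j = -(f j * f i)
  ef_anti : ∀ i < p, ∀ j < q, e i * f j = -(f j * e i)

/-- The subspace `N` is preserved by `e i`, `i < p`, and by `f j`, `j < q`. -/
def IsInvariant {M : Type*} [AddCommGroup M] [Module ℝ M] (p q : ℕ) (e f : ℕ → End ℝ M)
    (N : Submodule ℝ M) : Prop :=
  (∀ i < p, ∀ v ∈ N, e i v ∈ N) ∧ ∀ j < q, ∀ v ∈ N, f j v ∈ N

/-- For every Clifford system with `p` complex structures and `q` involutions, each nonzero
invariant subspace contains an invariant subspace of dimension `D`. -/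
def HasInvariantSubspace.{u} (p q D : ℕ) : Prop :=
  ∀ (M : Type u) [AddCommGroup M] [Module ℝ M] (e f : ℕ → End ℝ M), CliffordSystem p q e f →
    ∀ N : Submodule ℝ M, N ≠ ⊥ → IsInvariant p q e f N →
      ∃ U ≤ N, IsInvariant p q e f U ∧ FiniteDimensional ℝ U ∧ finrank ℝ U = D

universe u

/-- A complex structure and an involution split off a real matrix algebra of size two. -/
theorem HasInvariantSubspace.double {p q D : ℕ} (h : HasInvariantSubspace.{u} p q D) :
    HasInvariantSubspace.{u} (p + 1) (q + 1) (2 * D) := by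
  intro M _ _ e f hs N hN hinv
  have ee : ∀ v, e p (e p v) = -v := fun v => by
    simpa using congr($(hs.e_sq p (by omega)) v)
  have ff : ∀ v, f q (f q v) = v := fun v => by
    simpa using congr($(hs.f_sq q (by omega)) v)
  have ef : ∀ v, f q (e p v) = -e p (f q v) := fun v => by
    simpa using congr(-$(hs.ef_anti p (by omega) q (by omega)) v).symm
  have hei : ∀ i < p, ∀ v, e i (e p v) = -e p (e i v) := fun i hi v => by
    simpa using congr($(hs.e_anti i (by omega) p (by omega) (by omega)) v)
  have hif : ∀ i < p, ∀ v, f q (e i v) = -e i (f q v) := fun i hi v => by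
    simpa using congr(-$(hs.ef_anti i (by omega) q (by omega)) v).symm
  have hej : ∀ j < q, ∀ v, f j (e p v) = -e p (f j v) := fun i hi v => by
    simpa using congr(-$(hs.ef_anti p (by omega) i (by omega)) v).symm
  have hjf : ∀ j < q, ∀ v, f q (f j v) = -f j (f q v) := fun i hi v => by
    simpa using congr($(hs.f_anti q (by omega) i (by omega) (by omega)) v)
  -- The operator `e p * f q` is an involution commuting with all the remaining generators, so its
  -- fixed space in `N` is a module over the smaller system.
  set N' : Submodule ℝ M := N ⊓ LinearMap.eqLocus (e p * f q) 1 with hN'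
  have memN' : ∀ v, v ∈ N' ↔ v ∈ N ∧ e p (f q v) = v := fun v => by
    simp [hN']
  have hne : N' ≠ ⊥ := by
    obtain ⟨v, hv, hv0⟩ := N.ne_bot_iff.1 hN
    rw [Submodule.ne_bot_iff]
    -- Either the projection of `v` to the fixed space is nonzero, or `v` lies in the `-1`
    -- eigenspace, which `e p` carries to the fixed space.
    by_cases hw : v + e p (f q v) = 0
    · refine ⟨e p v, (memN' _).2 ⟨hinv.1 p (by omega) v hv, ?_⟩, fun h0 => hv0 ?_⟩
      · rw [ef, map_neg, ← map_neg, neg_eq_of_add_eq_zero_left hw]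
      · simpa [h0] using ee v
    · refine ⟨_, (memN' _).2 ⟨N.add_mem hv
        (hinv.1 p (by omega) _ (hinv.2 q (by omega) v hv)), ?_⟩, hw⟩
      simp only [map_add, ef, ff, map_neg, ee]
      abel
  have hs' : CliffordSystem p q e f :=
    ⟨fun i hi => hs.e_sq i (by omega), fun i hi => hs.f_sq i (by omega),
      fun i hi j hj => hs.e_anti i (by omega) j (by omega),
      fun i hi j hj => hs.f_anti i (by omega) j (by omega),
      fun i hi j hj => hs.ef_anti i (by omega) j (by omega)⟩
  obtain ⟨U, hU, hUinv, hUf, hUr⟩ := h M e f hs' N' hne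
    ⟨fun i hi v hv => by
      obtain ⟨h1, h2⟩ := (memN' v).1 hv
      refine (memN' _).2 ⟨hinv.1 i (by omega) v h1, ?_⟩
      rw [hif i hi, map_neg, ← neg_eq_iff_eq_neg.2 (hei i hi _), h2, neg_neg],
    fun j hj v hv => by
      obtain ⟨h1, h2⟩ := (memN' v).1 hv
      refine (memN' _).2 ⟨hinv.2 j (by omega) v h1, ?_⟩
      rw [hjf j hj, map_neg, ← neg_eq_iff_eq_neg.2 (hej j hj _), h2, neg_neg]⟩
  have hfix : ∀ u ∈ U, e p (f q u) = u := fun u hu => ((memN' u).1 (hU hu)).2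
  have hinj : Function.Injective (e p) := fun a b hab => by
    have := congr(e p $hab)
    rwa [ee, ee, neg_inj] at this
  -- `e p` maps the `+1` eigenspace of `e p * f q` into the `-1` eigenspace.
  have hdisj : U ⊓ U.map (e p) = ⊥ := by
    rw [eq_bot_iff]
    rintro _ ⟨hx, y, hy, rfl⟩
    have h1 := hfix _ hx
    rw [ef, map_neg, hfix y hy] at h1
    have h2 : (2 : ℝ) • e p y = 0 := by rw [two_smul]; nth_rw 1 [← h1]; abel
    simpa using h2
  refine ⟨U ⊔ U.map (e p), sup_le (hU.trans inf_le_left) ?_, ⟨?_, ?_⟩, inferInstance, ?_⟩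
  · rintro _ ⟨y, hy, rfl⟩
    exact hinv.1 p (by omega) y (hU hy).1
  · intro i hi
    simp only [Submodule.forall_mem_sup, Submodule.mem_map, forall_exists_index, and_imp,
      forall_apply_eq_imp_iff₂, map_add]
    intro a ha b hb
    rcases Nat.lt_succ_iff_lt_or_eq.1 hi with hi | rfl
    · rw [hei i hi, ← map_neg]
      exact Submodule.add_mem_sup (hUinv.1 i hi a ha)
        (Submodule.mem_map_of_mem (U.neg_mem (hUinv.1 i hi b hb)))
    · rw [ee, add_comm]
      exact Submodule.add_mem_sup (U.neg_mem hb) (Submodule.mem_map_of_mem ha)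
  · intro i hi
    simp only [Submodule.forall_mem_sup, Submodule.mem_map, forall_exists_index, and_imp,
      forall_apply_eq_imp_iff₂, map_add]
    intro a ha b hb
    rcases Nat.lt_succ_iff_lt_or_eq.1 hi with hi | rfl
    · rw [hej i hi, ← map_neg]
      exact Submodule.add_mem_sup (hUinv.2 i hi a ha)
        (Submodule.mem_map_of_mem (U.neg_mem (hUinv.2 i hi b hb)))
    · have : f i a = e p (-a) := by
        rw [map_neg]; nth_rw 2 [← hfix a ha]; rw [ee, neg_neg]
      rw [ef, hfix b hb, this, add_comm]
      exact Submodule.add_mem_sup (U.neg_mem hb) (Submodule.mem_map_of_mem (U.neg_mem ha))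
  · have h1 := Submodule.finrank_sup_add_finrank_inf_eq U (U.map (e p))
    rw [hdisj, finrank_bot, ← (Submodule.equivMapOfInjective (e p) hinj U).finrank_eq, hUr] at h1
    omega

/-- Four complex structures with product `ω` generate the same algebra as the four involutions
`ω * e i`. -/
theorem HasInvariantSubspace.exchange {p q D : ℕ} (h : HasInvariantSubspace.{u} p (q + 4) D) :
    HasInvariantSubspace.{u} (p + 4) q D := by
  intro M _ _ e f hs N hN hinv
  have hsq : ∀ k < 4, e (p + k) * e (p + k) = -1 := fun k hk => hs.e_sq _ (by omega)
  have hsq' : ∀ k < 4, ∀ x, e (p + k) * (e (p + k) * x) = -x := fun k hk x => by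
    rw [← mul_assoc, hsq k hk, neg_one_mul]
  have han : ∀ k < 4, ∀ l < k, e (p + k) * e (p + l) = -(e (p + l) * e (p + k)) :=
    fun k hk l hl => hs.e_anti _ (by omega) _ (by omega) (by omega)
  have han' : ∀ k < 4, ∀ l < k, ∀ x, e (p + k) * (e (p + l) * x) = -(e (p + l) * (e (p + k) * x)) :=
    fun k hk l hl x => by rw [← mul_assoc, han k hk l hl, neg_mul, mul_assoc]
  obtain ⟨ω, hω⟩ : ∃ ω, ω = e (p + 0) * (e (p + 1) * (e (p + 2) * e (p + 3))) := ⟨_, rfl⟩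
  have hωω : ω * ω = 1 := by
    simp (discharger := omega) only [hω, mul_assoc, han', hsq, mul_neg, neg_neg, mul_one]
  have hωe : ∀ k < 4, e (p + k) * ω = -(ω * e (p + k)) := by
    intro k hk
    interval_cases k <;>
    simp (discharger := omega) only [hω, mul_assoc, han, han', hsq, hsq', mul_neg,
      neg_neg, mul_one]
  -- Four sign changes cancel: whatever anticommutes with all four factors commutes with `ω`.
  have hωc : ∀ g : End ℝ M, (∀ k < 4, g * e (p + k) = -(e (p + k) * g)) → g * ω = ω * g := by
    intro g hg
    have hg' : ∀ k < 4, ∀ x, g * (e (p + k) * x) = -(e (p + k) * (g * x)) := fun k hk x => by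
      rw [← mul_assoc, hg k hk, neg_mul, mul_assoc]
    simp (discharger := omega) only [hω, mul_assoc, hg, hg', mul_neg, neg_neg]
  have hωω' : ∀ x, ω * (ω * x) = x := fun x => by rw [← mul_assoc, hωω, one_mul]
  have hprod : ∀ k < 4, ∀ l < 4, ω * e (p + k) * (ω * e (p + l)) = -(e (p + k) * e (p + l)) := by
    intro k hk l hl
    rw [mul_assoc, ← mul_assoc (e _) ω, hωe k hk, neg_mul, mul_assoc, mul_neg, hωω']
  set f' : ℕ → End ℝ M := fun j => if j < q then f j else ω * e (p + (j - q)) with hf'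
  have f'1 : ∀ j < q, f' j = f j := fun j hj => if_pos hj
  have f'2 : ∀ k, f' (q + k) = ω * e (p + k) := fun k => by simp [hf']
  have hcase : ∀ j < q + 4, j < q ∨ ∃ k < 4, j = q + k := fun j hj => by
    by_cases h : j < q
    · exact .inl h
    · exact .inr ⟨j - q, by omega, by omega⟩
  have hgω : ∀ g : End ℝ M, (∀ k < 4, g * e (p + k) = -(e (p + k) * g)) →
      ∀ k < 4, g * (ω * e (p + k)) = -(ω * e (p + k) * g) := fun g hg k hk => by
    rw [← mul_assoc, hωc g hg, mul_assoc, hg k hk, mul_neg, mul_assoc]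
  have hfe : ∀ j < q, ∀ k < 4, f j * e (p + k) = -(e (p + k) * f j) := fun j hj k hk => by
    rw [hs.ef_anti _ (by omega) j hj, neg_neg]
  have hs' : CliffordSystem p (q + 4) e f' := by
    refine ⟨fun i hi => hs.e_sq i (by omega), fun j hj => ?_,
      fun i hi j hj => hs.e_anti i (by omega) j (by omega), fun i hi j hj hij => ?_,
      fun i hi j hj => ?_⟩
    · rcases hcase j hj with h | ⟨k, hk, rfl⟩
      · rw [f'1 j h, hs.f_sq j h]
      · rw [f'2, hprod k hk k hk, hsq k hk, neg_neg]
    · rcases hcase i hi with h | ⟨k, hk, rfl⟩ <;> rcases hcase j hj with h' | ⟨l, hl, rfl⟩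
      · rw [f'1 i h, f'1 j h', hs.f_anti i h j h' hij]
      · rw [f'1 i h, f'2, hgω _ (hfe i h) l hl]
      · rw [f'1 j h', f'2, hgω _ (hfe j h') k hk, neg_neg]
      · rw [f'2, f'2, hprod k hk l hl, hprod l hl k hk,
          hs.e_anti (p + k) (by omega) (p + l) (by omega) (by omega)]
    · rcases hcase j hj with h | ⟨k, hk, rfl⟩
      · rw [f'1 j h, hs.ef_anti i (by omega) j h]
      · rw [f'2]
        exact hgω _ (fun l hl => hs.e_anti _ (by omega) _ (by omega) (by omega)) k hk
  have hNinv : IsInvariant p (q + 4) e f' N := by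
    refine ⟨fun i hi => hinv.1 i (by omega), fun j hj v hv => ?_⟩
    rcases hcase j hj with h | ⟨k, hk, rfl⟩
    · rw [f'1 j h]; exact hinv.2 j h v hv
    · rw [f'2, hω]
      exact hinv.1 _ (by omega) _ (hinv.1 _ (by omega) _ (hinv.1 _ (by omega) _
        (hinv.1 _ (by omega) _ (hinv.1 _ (by omega) _ hv))))
  obtain ⟨U, hU, hUinv, hUf, hUr⟩ := h M e f' hs' N hN hNinv
  refine ⟨U, hU, ⟨fun i hi v hv => ?_, fun j hj v hv => ?_⟩, hUf, hUr⟩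
  · by_cases hip : i < p
    · exact hUinv.1 i hip v hv
    obtain ⟨k, hk, rfl⟩ : ∃ k < 4, i = p + k := ⟨i - p, by omega, by omega⟩
    -- The four new involutions have the same product `ω`, so the old complex structures are
    -- recovered as `ω * f'`.
    have h4 : f' (q + 0) * f' (q + 1) * (f' (q + 2) * f' (q + 3)) = ω := by
      rw [f'2, f'2, f'2, f'2, hprod _ (by omega) _ (by omega), hprod _ (by omega) _ (by omega),
        neg_mul_neg, hω, mul_assoc]
    have hek : e (p + k) = f' (q + 0) * f' (q + 1) * (f' (q + 2) * f' (q + 3)) * f' (q + k) := by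
      rw [h4, f'2, hωω']
    rw [hek]
    have hf := fun k (hk : k < 4) => hUinv.2 (q + k) (by omega)
    exact hf _ (by omega) _ (hf _ (by omega) _ (hf _ (by omega) _ (hf _ (by omega) _
      (hf k hk v hv))))
  · rw [← f'1 j hj]; exact hUinv.2 j (by omega) v hv

/-- The involutions `f j`, `j ≤ q`, generate the same algebra as the involution `f q` and the
complex structures `f q * f j`, `j < q`. -/
theorem HasInvariantSubspace.of_involution {q D : ℕ} (h : HasInvariantSubspace.{u} q 1 D) :
    HasInvariantSubspace.{u} 0 (q + 1) D := by
  intro M _ _ e f hs N hN hinv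
  have hqq : f q * f q = 1 := hs.f_sq q (by omega)
  have hqj : ∀ j < q, f j * f q = -(f q * f j) := fun j hj =>
    hs.f_anti j (by omega) q (by omega) (by omega)
  have hprod : ∀ i < q, ∀ j, f q * f i * (f q * f j) = -(f i * f j) := fun i hi j => by
    rw [mul_assoc, ← mul_assoc (f i), hqj i hi, neg_mul, mul_neg, mul_assoc, ← mul_assoc (f q), hqq,
      one_mul]
  have hs' : CliffordSystem q 1 (fun j => f q * f j) (fun _ => f q) := by
    refine ⟨fun i hi => ?_, fun j hj => hqq, fun i hi j hj hij => ?_, fun i hi j hj hij => by omega,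
      fun i hi j hj => ?_⟩
    · rw [hprod i hi, hs.f_sq i (by omega)]
    · rw [hprod i hi, hprod j hj, hs.f_anti i (by omega) j (by omega) hij]
    · rw [mul_assoc, hqj i hi, mul_neg]
  obtain ⟨U, hU, hUinv, hUf, hUr⟩ := h M _ _ hs' N hN
    ⟨fun i hi v hv => hinv.2 q (by omega) _ (hinv.2 i (by omega) v hv),
      fun j hj => hinv.2 q (by omega)⟩
  refine ⟨U, hU, ⟨fun i hi => by omega, fun j hj v hv => ?_⟩, hUf, hUr⟩
  rcases Nat.lt_succ_iff_lt_or_eq.1 hj with hj | rfl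
  · have : f j = f q * (f q * f j) := by rw [← mul_assoc, hqq, one_mul]
    rw [this]
    exact hUinv.2 0 (by omega) _ (hUinv.1 j hj v hv)
  · exact hUinv.2 0 (by omega) v hv

/-! ### Base cases: real, complex and quaternionic modules -/

theorem hasInvariantSubspace_zero_zero : HasInvariantSubspace.{u} 0 0 1 := by
  intro M _ _ e f hs N hN hinv
  obtain ⟨v, hv, hv0⟩ := N.ne_bot_iff.1 hN
  refine ⟨Submodule.span ℝ {v}, by simpa using hv, ⟨by simp, by simp⟩, inferInstance,
    finrank_span_singleton hv0⟩

theorem hasInvariantSubspace_zero_one : HasInvariantSubspace.{u} 0 1 1 := by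
  intro M _ _ e f hs N hN hinv
  obtain ⟨v, hv, hv0⟩ := N.ne_bot_iff.1 hN
  have ff : ∀ v, f 0 (f 0 v) = v := fun v => by
    simpa using congr($(hs.f_sq 0 (by omega)) v)
  obtain ⟨w, hw, hw0, c, hc⟩ : ∃ w ∈ N, w ≠ 0 ∧ ∃ c : ℝ, f 0 w = c • w := by
    by_cases hw : v + f 0 v = 0
    · exact ⟨v, hv, hv0, -1, by rw [neg_one_smul]; exact eq_neg_of_add_eq_zero_right hw⟩
    · exact ⟨_, N.add_mem hv (hinv.2 0 (by omega) v hv), hw, 1, by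
        rw [map_add, ff, one_smul, add_comm]⟩
  refine ⟨Submodule.span ℝ {w}, by simpa using hw, ⟨by simp, fun j hj x hx => ?_⟩, inferInstance,
    finrank_span_singleton hw0⟩
  obtain rfl : j = 0 := by omega
  obtain ⟨a, rfl⟩ := Submodule.mem_span_singleton.1 hx
  rw [map_smul, hc]
  exact Submodule.smul_mem _ _ (Submodule.smul_mem _ _ (Submodule.mem_span_singleton_self w))

theorem map_mem_span_range {M : Type*} [AddCommGroup M] [Module ℝ M] {k : ℕ} {w : Fin k → M}
    {g : End ℝ M} (h : ∀ i, g (w i) ∈ Submodule.span ℝ (Set.range w)) :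
    ∀ x ∈ Submodule.span ℝ (Set.range w), g x ∈ Submodule.span ℝ (Set.range w) := by
  have : Submodule.span ℝ (Set.range w) ≤ (Submodule.span ℝ (Set.range w)).comap g :=
    Submodule.span_le.2 (by rintro _ ⟨i, rfl⟩; exact h i)
  exact fun x hx => this hx

theorem hasInvariantSubspace_one_zero : HasInvariantSubspace.{u} 1 0 2 := by
  intro M _ _ e f hs N hN hinv
  obtain ⟨v, hv, hv0⟩ := N.ne_bot_iff.1 hN
  have ee : ∀ v, e 0 (e 0 v) = -v := fun v => by
    simpa using congr($(hs.e_sq 0 (by omega)) v)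
  have hli : LinearIndependent ℝ ![v, e 0 v] := by
    rw [LinearIndependent.pair_iff]
    intro a b hab
    have h1 := congr(e 0 $hab)
    simp only [map_add, map_smul, ee, map_zero] at h1
    -- Apply the conjugate `a - b e₀` to the relation `(a + b e₀)v = 0`.
    have h2 : (a ^ 2 + b ^ 2) • v = 0 := by
      linear_combination (norm := module) a • hab - b • h1
    rcases smul_eq_zero.1 h2 with h | h
    · constructor <;> nlinarith
    · exact absurd h hv0
  refine ⟨Submodule.span ℝ (Set.range ![v, e 0 v]), ?_, ⟨fun i hi => ?_, by simp⟩,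
    FiniteDimensional.span_of_finite ℝ (Set.finite_range _), by simpa using finrank_span_eq_card hli⟩
  · rw [Submodule.span_le]
    rintro _ ⟨i, rfl⟩
    have := hinv.1 0 (by omega) v hv
    fin_cases i <;> assumption
  · obtain rfl : i = 0 := by omega
    refine map_mem_span_range (fun k => ?_)
    have hmem : ∀ k, ![v, e 0 v] k ∈ Submodule.span ℝ (Set.range ![v, e 0 v]) :=
      fun k => Submodule.subset_span (Set.mem_range_self k)
    generalize Submodule.span ℝ (Set.range ![v, e 0 v]) = U at hmem ⊢
    have h0 : v ∈ U := hmem 0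
    have h1 : e 0 v ∈ U := hmem 1
    fin_cases k <;> simpa [ee]

theorem hasInvariantSubspace_two_zero : HasInvariantSubspace.{u} 2 0 4 := by
  intro M _ _ e f hs N hN hinv
  obtain ⟨v, hv, hv0⟩ := N.ne_bot_iff.1 hN
  have e00 : ∀ v, e 0 (e 0 v) = -v := fun v => by
    simpa using congr($(hs.e_sq 0 (by omega)) v)
  have e11 : ∀ v, e 1 (e 1 v) = -v := fun v => by
    simpa using congr($(hs.e_sq 1 (by omega)) v)
  have e10 : ∀ v, e 1 (e 0 v) = -e 0 (e 1 v) := fun v => by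
    simpa using congr($(hs.e_anti 1 (by omega) 0 (by omega) (by omega)) v)
  have hli : LinearIndependent ℝ ![v, e 0 v, e 1 v, e 0 (e 1 v)] := by
    rw [Fintype.linearIndependent_iff]
    intro g hg
    simp only [Fin.sum_univ_four, Matrix.cons_val] at hg
    have h1 := congr(e 0 $hg)
    have h2 := congr(e 1 $hg)
    have h3 := congr(e 0 (e 1 $hg))
    simp only [map_add, map_smul, map_neg, e00, e10, e11, map_zero] at h1 h2 h3
    -- Apply the conjugate quaternion: the product is the quaternion norm, a sum of squares.
    have h4 : (g 0 ^ 2 + g 1 ^ 2 + g 2 ^ 2 + g 3 ^ 2) • v = 0 := by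
      linear_combination (norm := module) g 0 • hg - g 1 • h1 - g 2 • h2 - g 3 • h3
    rcases smul_eq_zero.1 h4 with h | h
    · intro i
      fin_cases i <;> simp <;> nlinarith [sq_nonneg (g 0), sq_nonneg (g 1), sq_nonneg (g 2),
        sq_nonneg (g 3)]
    · exact absurd h hv0
  refine ⟨Submodule.span ℝ (Set.range ![v, e 0 v, e 1 v, e 0 (e 1 v)]), ?_,
    ⟨fun i hi => ?_, by simp⟩,
    FiniteDimensional.span_of_finite ℝ (Set.finite_range _), by simpa using finrank_span_eq_card hli⟩
  · rw [Submodule.span_le]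
    rintro _ ⟨i, rfl⟩
    have h0 := hinv.1 0 (by omega)
    have h1 := hinv.1 1 (by omega)
    fin_cases i
    exacts [hv, h0 _ hv, h1 _ hv, h0 _ (h1 _ hv)]
  · refine map_mem_span_range (fun k => ?_)
    have hmem : ∀ k, ![v, e 0 v, e 1 v, e 0 (e 1 v)] k ∈
        Submodule.span ℝ (Set.range ![v, e 0 v, e 1 v, e 0 (e 1 v)]) :=
      fun k => Submodule.subset_span (Set.mem_range_self k)
    generalize Submodule.span ℝ (Set.range ![v, e 0 v, e 1 v, e 0 (e 1 v)]) = U at hmem ⊢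
    have h0 : v ∈ U := hmem 0
    have h1 : e 0 v ∈ U := hmem 1
    have h2 : e 1 v ∈ U := hmem 2
    have h3 : e 0 (e 1 v) ∈ U := hmem 3
    interval_cases i <;> fin_cases k <;> simpa [e00, e10, e11]

/-- The volume element `ω = e₀e₁e₂` is a central involution. On an eigenspace of it, `e₂` is a
multiple of `e₁e₀`, so a quaternionic line for `e₀, e₁` is already invariant under `e₂`. -/
theorem hasInvariantSubspace_three_zero : HasInvariantSubspace.{u} 3 0 4 := by
  intro M _ _ e f hs N hN hinv
  obtain ⟨v, hv, hv0⟩ := N.ne_bot_iff.1 hN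
  have hsq : ∀ i < 3, ∀ v, e i (e i v) = -v := fun i hi v => by
    simpa using congr($(hs.e_sq i (by omega)) v)
  have han : ∀ i < 3, ∀ j < i, ∀ v, e i (e j v) = -e j (e i v) := fun i hi j hj v => by
    simpa using congr($(hs.e_anti i (by omega) j (by omega) (by omega)) v)
  obtain ⟨ω, hω⟩ : ∃ ω, ω = e 0 * (e 1 * e 2) := ⟨_, rfl⟩
  have hωa : ∀ v, ω v = e 0 (e 1 (e 2 v)) := fun _ => by rw [hω]; rfl
  have hωω : ∀ v, ω (ω v) = v := fun v => by
    simp (discharger := omega) only [hωa, hsq, han, map_neg, neg_neg]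
  have hωe : ∀ i < 3, ∀ v, ω (e i v) = e i (ω v) := fun i hi v => by
    interval_cases i <;> simp (discharger := omega) only [hωa, hsq, han, map_neg, neg_neg]
  obtain ⟨w, hw, hw0, c, hc⟩ : ∃ w ∈ N, w ≠ 0 ∧ ∃ c : ℝ, ω w = c • w := by
    by_cases hw : v + ω v = 0
    · exact ⟨v, hv, hv0, -1, by rw [neg_one_smul]; exact eq_neg_of_add_eq_zero_right hw⟩
    · have hωv : ω v ∈ N := by
        rw [hωa]
        exact hinv.1 0 (by omega) _ (hinv.1 1 (by omega) _ (hinv.1 2 (by omega) v hv))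
      exact ⟨_, N.add_mem hv hωv, hw, 1, by rw [map_add, hωω, one_smul, add_comm]⟩
  set N' : Submodule ℝ M := N ⊓ LinearMap.eqLocus ω (c • LinearMap.id) with hN'
  have memN' : ∀ v, v ∈ N' ↔ v ∈ N ∧ ω v = c • v := fun v => by simp [hN']
  obtain ⟨U, hU, hUinv, hUf, hUr⟩ := hasInvariantSubspace_two_zero M e f
    ⟨fun i hi => hs.e_sq i (by omega), by simp, fun i hi j hj => hs.e_anti i (by omega) j (by omega),
      by simp, by simp⟩ N' (N'.ne_bot_iff.2 ⟨w, (memN' w).2 ⟨hw, hc⟩, hw0⟩)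
    ⟨fun i hi u hu => (memN' _).2 ⟨hinv.1 i (by omega) u ((memN' u).1 hu).1, by
      rw [hωe i (by omega), ((memN' u).1 hu).2, map_smul]⟩, by simp⟩
  refine ⟨U, hU.trans inf_le_left, ⟨fun i hi u hu => ?_, by simp⟩, hUf, hUr⟩
  by_cases hi2 : i < 2
  · exact hUinv.1 i hi2 u hu
  obtain rfl : i = 2 := by omega
  have h1 : e 2 u = c • e 1 (e 0 u) := by
    have h2 := congr(e 1 (e 0 $(((memN' u).1 (hU hu)).2)))
    simpa (discharger := omega) only [hωa, hsq, map_neg, neg_neg, map_smul] using h2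
  rw [h1]
  exact U.smul_mem _ (hUinv.1 1 (by omega) _ (hUinv.1 0 (by omega) u hu))

/-! ### Eightfold periodicity -/

theorem d_succ_add_eight (m : ℕ) : d (m + 8 + 1) = 2 * (2 * (2 * (2 * d (m + 1)))) := by
  have h1 : (m + 8) % 8 = m % 8 := by omega
  have h2 : (m + 8) / 8 = m / 8 + 1 := by omega
  simp only [d, Nat.add_sub_cancel, h1, h2, pow_succ]
  ring

/-- A nonzero module over the Clifford algebra with `m` generators of square `-1` contains a
submodule of dimension `d (m + 1)`. -/
theorem hasInvariantSubspace_d : ∀ m : ℕ, HasInvariantSubspace.{u} m 0 (d (m + 1))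
  | 0 => hasInvariantSubspace_zero_zero
  | 1 => hasInvariantSubspace_one_zero
  | 2 => hasInvariantSubspace_two_zero
  | 3 => hasInvariantSubspace_three_zero
  -- The pairs `(p, q)` run through `(2,0) → (3,1) → (0,4) → (4,0)`; the next three cases likewise
  -- reach some `(p, 4)` before exchanging.
  | 4 => hasInvariantSubspace_two_zero.double.of_involution.exchange
  | 5 => hasInvariantSubspace_one_zero.double.of_involution.double.exchange
  | 6 => hasInvariantSubspace_zero_zero.double.of_involution.double.double.exchange
  | 7 => hasInvariantSubspace_zero_one.double.double.double.exchange
  | m + 8 => by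
    rw [d_succ_add_eight]
    -- `(m, 0) → (m+4, 4) → (m+8, 0)`.
    exact (hasInvariantSubspace_d m).double.double.double.double.exchange

end CliffordSystems

/-! ### Transverse spheres of isotropic flags -/

section TransverseSpheres

variable {E S : Type*} [NormedAddCommGroup E] [InnerProductSpace ℝ E]
  [NormedAddCommGroup S] [InnerProductSpace ℝ S]

@[simp]
theorem idSum_fst (g : S ≃ₗᵢ[ℝ] S) (w : Pseudo E S) : (idSum g w).fst = w.fst := rfl

@[simp]
theorem idSum_snd (g : S ≃ₗᵢ[ℝ] S) (w : Pseudo E S) : (idSum g w).snd = g w.snd := rfl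

theorem form_isSymm : (form E S).IsSymm :=
  ⟨fun u v => by
    simp only [form_apply, real_inner_comm]⟩

theorem form_nondegenerate : (form E S).Nondegenerate := by
  have h : ∀ u : Pseudo E S, (∀ v, form E S u v = 0) → u = 0 := fun u hu => by
    have h1 := hu (WithLp.toLp 2 (u.fst, 0))
    have h2 := hu (WithLp.toLp 2 (0, u.snd))
    rw [form_apply] at h1 h2
    refine (WithLp.ofLp_injective 2) (Prod.ext ?_ ?_)
    · simpa using h1
    · simpa using h2
  exact ⟨h, fun u hu => h u fun v => by
    rw [← form_isSymm.eq v u]; exact hu v⟩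

/-- The isometry `id ⊕ g` of the Euclidean space `E ⊕ S`. -/
noncomputable def idSumIsometry (g : S ≃ₗᵢ[ℝ] S) : Pseudo E S ≃ₗᵢ[ℝ] Pseudo E S :=
  (idSum g).isometryOfInner fun u v => by
    simp only [WithLp.prod_inner_apply]
    change inner ℝ u.fst v.fst + inner ℝ (g u.snd) (g v.snd) = _
    rw [g.inner_map_map]
    rfl

/-- A subspace is determined by its orthogonal projection. Separation is what makes a continuous
injection of the compact sphere an embedding. -/
instance {r : ℕ} : T2Space (IsoFlag E S r) := by
  refine T2Space.of_injective_continuous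
    (f := fun F (i : Fin r) => ((F.space i).starProjection : Pseudo E S →L[ℝ] Pseudo E S))
    (fun F G h => ?_) continuous_induced_dom
  ext1
  funext i
  exact Submodule.starProjection_inj.1 (congrFun h i)

theorem continuous_of_norm_sub_le {X W : Type*} [NormedAddCommGroup X] [NormedAddCommGroup W]
    [NormedSpace ℝ W] {A : Set X} {T : A → W →L[ℝ] W}
    (hT : ∀ x y, ‖T x - T y‖ ≤ ‖(x : X) - y‖) : Continuous T :=
  (LipschitzWith.of_dist_le_mul (K := 1) fun x y => by
    simpa [dist_eq_norm, Subtype.dist_eq] using hT x y).continuous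

variable {X : Type*} [NormedAddCommGroup X] [InnerProductSpace ℝ X]
  {g : Metric.sphere (0 : X) 1 → S ≃ₗᵢ[ℝ] S}

theorem norm_sub_of_inner_eq
    (hg : ∀ x y s, inner ℝ (g x s) (g y s) = inner ℝ (x : X) (y : X) * ‖s‖ ^ 2)
    (x y : Metric.sphere (0 : X) 1) (s : S) : ‖g x s - g y s‖ = ‖(x : X) - y‖ * ‖s‖ := by
  have hx : ‖(x : X)‖ = 1 := by simp
  have hy : ‖(y : X)‖ = 1 := by simp
  rw [← sq_eq_sq₀ (norm_nonneg _) (by positivity), mul_pow, norm_sub_sq_real, norm_sub_sq_real,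
    hg, LinearIsometryEquiv.norm_map, LinearIsometryEquiv.norm_map, hx, hy]
  ring

/-- Along a flag, `b(g x u, g y u) = 0` only for `u = 0`. -/
theorem eq_zero_of_form_eq_zero
    (hg : ∀ x y s, inner ℝ (g x s) (g y s) = inner ℝ (x : X) (y : X) * ‖s‖ ^ 2)
    {x y : Metric.sphere (0 : X) 1} (hxy : x ≠ y) {u : Pseudo E S} (hu : form E S u u = 0)
    (h : form E S (idSum (g x) u) (idSum (g y) u) = 0) : u = 0 := by
  have hx : ‖(x : X)‖ = 1 := by simp
  have hy : ‖(y : X)‖ = 1 := by simp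
  rw [form_apply, real_inner_self_eq_norm_sq, real_inner_self_eq_norm_sq] at hu
  rw [form_apply, idSum_fst, idSum_snd, idSum_fst, idSum_snd, hg, real_inner_self_eq_norm_sq] at h
  have hlt : inner ℝ (x : X) (y : X) ≠ 1 := fun h1 =>
    hxy (Subtype.ext ((inner_eq_one_iff_of_norm_eq_one hx hy).1 h1))
  -- Subtract the isotropy relation `‖u.fst‖² = ‖u.snd‖²`.
  have h2 : (1 - inner ℝ (x : X) (y : X)) * ‖u.snd‖ ^ 2 = 0 := by linear_combination h - hu
  have h3 : ‖u.snd‖ ^ 2 = 0 := (mul_eq_zero.1 h2).resolve_left (sub_ne_zero.2 hlt.symm)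
  have h4 : ‖u.fst‖ ^ 2 = 0 := by linear_combination hu + h3
  refine (WithLp.ofLp_injective 2) (Prod.ext ?_ ?_)
  · simpa using h4
  · simpa using h3

theorem norm_idSumIsometry_sub_le
    (hg : ∀ x y s, inner ℝ (g x s) (g y s) = inner ℝ (x : X) (y : X) * ‖s‖ ^ 2)
    (x y : Metric.sphere (0 : X) 1) :
    ‖(((idSumIsometry (g x) : Pseudo E S ≃ₗᵢ[ℝ] Pseudo E S) : Pseudo E S →L[ℝ] Pseudo E S) -
      ((idSumIsometry (g y) : Pseudo E S ≃ₗᵢ[ℝ] Pseudo E S) : Pseudo E S →L[ℝ] Pseudo E S))‖ ≤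
      ‖(x : X) - y‖ := by
  refine ContinuousLinearMap.opNorm_le_bound _ (norm_nonneg _) fun u => ?_
  have h1 : (((idSumIsometry (g x) : Pseudo E S ≃ₗᵢ[ℝ] Pseudo E S) :
      Pseudo E S →L[ℝ] Pseudo E S) - ((idSumIsometry (g y) : Pseudo E S ≃ₗᵢ[ℝ] Pseudo E S) :
      Pseudo E S →L[ℝ] Pseudo E S)) u = WithLp.toLp 2 (0, g x u.snd - g y u.snd) :=
    (WithLp.ofLp_injective 2) (Prod.ext (sub_self u.fst) rfl)
  rw [h1, WithLp.norm_toLp_snd, norm_sub_of_inner_eq hg]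
  gcongr
  exact WithLp.norm_snd_le _ u

theorem continuous_idSumIsometry
    (hg : ∀ x y s, inner ℝ (g x s) (g y s) = inner ℝ (x : X) (y : X) * ‖s‖ ^ 2) :
    Continuous fun x => ((idSumIsometry (g x) : Pseudo E S ≃ₗᵢ[ℝ] Pseudo E S) :
      Pseudo E S →L[ℝ] Pseudo E S) := by
  exact continuous_of_norm_sub_le (W := Pseudo E S) (norm_idSumIsometry_sub_le hg)

/-- If the two flags agree, `β(x)u` and `β(y)u` lie in one isotropic line for `u` in the first
member, hence pair to zero. This is where `r ≥ 1` is needed. -/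
theorem IsoFlag.injective_map_idSum {r : ℕ} (hr : 1 ≤ r) (F : IsoFlag E S r)
    (hg : ∀ x y s, inner ℝ (g x s) (g y s) = inner ℝ (x : X) (y : X) * ‖s‖ ^ 2) :
    Function.Injective fun x => F.map (idSum (g x)) (form_idSum (g x)) := by
  intro x y h
  by_contra hxy
  have hF : F.space ⟨0, hr⟩ ≠ ⊥ := fun h0 => by
    have := F.finrank_space ⟨0, hr⟩
    rw [h0, finrank_bot] at this
    omega
  obtain ⟨u, hu, hu0⟩ := (Submodule.ne_bot_iff _).1 hF
  refine hu0 (eq_zero_of_form_eq_zero hg hxy (F.isotropic _ u hu u hu) ?_)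
  refine (F.map (idSum (g y)) (form_idSum (g y))).isotropic ⟨0, hr⟩ _ ?_ _
    (Submodule.mem_map_of_mem hu)
  rw [← show F.map (idSum (g x)) _ = F.map (idSum (g y)) _ from h]
  exact Submodule.mem_map_of_mem hu

variable [FiniteDimensional ℝ E] [FiniteDimensional ℝ S]

/-- `id ⊕ g x` is also a Euclidean isometry, so the projection onto the image of a subspace is the
conjugate `T P T*`, and `T` is 1-Lipschitz in `x`. -/
theorem IsoFlag.continuous_map_idSum {r : ℕ} (F : IsoFlag E S r)
    (hg : ∀ x y s, inner ℝ (g x s) (g y s) = inner ℝ (x : X) (y : X) * ‖s‖ ^ 2) :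
    Continuous fun x => F.map (idSum (g x)) (form_idSum (g x)) := by
  have := FiniteDimensional.complete ℝ (Pseudo E S)
  rw [continuous_induced_rng]
  refine continuous_pi fun i => ?_
  have h := continuous_idSumIsometry (E := E) hg
  have h' := (ContinuousLinearMap.adjoint (𝕜 := ℝ) (E := Pseudo E S)
    (F := Pseudo E S)).continuous.comp h
  refine (h.clm_comp (continuous_const (y := (F.space i).starProjection)|>.clm_comp h')).congr
    fun x => ?_
  ext1 w
  simp only [Function.comp_apply, LinearIsometryEquiv.adjoint_eq_symm]
  exact (Submodule.starProjection_map_apply (idSumIsometry (g x)) (F.space i) w).symm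

theorem IsoFlag.transverse_map_idSum {r : ℕ} (F : IsoFlag E S r)
    (hg : ∀ x y s, inner ℝ (g x s) (g y s) = inner ℝ (x : X) (y : X) * ‖s‖ ^ 2)
    {x y : Metric.sphere (0 : X) 1} (hxy : x ≠ y) :
    Transverse (F.map (idSum (g x)) (form_idSum (g x)))
      (F.map (idSum (g y)) (form_idSum (g y))) := by
  intro i
  -- Nondegeneracy makes the dimensions complementary, so trivial intersection is enough.
  refine Submodule.eq_top_of_disjoint _ _ ?_ ?_
  · rw [LinearMap.BilinForm.finrank_orthogonal form_nondegenerate,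
      IsoFlag.finrank_space, IsoFlag.finrank_space]
    omega
  · rw [Submodule.disjoint_def]
    rintro _ ⟨u, hu, rfl⟩ h
    have h1 := LinearMap.BilinForm.mem_orthogonal_iff.1 h (idSum (g y) u)
      (Submodule.mem_map_of_mem hu)
    have h2 := eq_zero_of_form_eq_zero hg hxy.symm (F.isotropic i u hu u hu) h1
    rw [h2, map_zero]

/-- If the isometries `g x` satisfy `⟨g x s, g y s⟩ = ⟨x, y⟩ ‖s‖²`, then every orbit map
`x ↦ (id ⊕ g x) F` is an embedding onto a transverse sphere. -/
theorem IsoFlag.isTransverseSphere_range {m r : ℕ} (hr : 1 ≤ r) (F : IsoFlag E S r)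
    {g : Metric.sphere (0 : V (m + 1)) 1 → S ≃ₗᵢ[ℝ] S}
    (hg : ∀ x y s, inner ℝ (g x s) (g y s) = inner ℝ (x : V (m + 1)) (y : V (m + 1)) * ‖s‖ ^ 2) :
    Topology.IsEmbedding (fun x => F.map (idSum (g x)) (form_idSum (g x))) ∧
      IsTransverseSphere m (Set.range fun x => F.map (idSum (g x)) (form_idSum (g x))) := by
  have hemb := ((F.continuous_map_idSum hg).isClosedEmbedding
    (F.injective_map_idSum hr hg)).isEmbedding
  refine ⟨hemb, ⟨hemb.toHomeomorph.symm⟩, ?_⟩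
  rintro _ ⟨x, rfl⟩ _ ⟨y, rfl⟩ hne
  exact F.transverse_map_idSum hg fun h => hne (by rw [h])

end TransverseSpheres

/-! ### Spinors -/

section Spinors

theorem polar_negSq {n : ℕ} (x y : V n) :
    QuadraticMap.polar (negSq n) x y = -(2 * inner ℝ x y) := by
  rw [QuadraticMap.polar, negSq_apply, negSq_apply, negSq_apply, norm_add_sq_real]
  ring

theorem ι_mul_ι_anticomm {n : ℕ} {x y : V n} (h : inner ℝ x y = 0) :
    ι (negSq n) x * ι (negSq n) y = -(ι (negSq n) y * ι (negSq n) x) := by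
  rw [eq_neg_iff_add_eq_zero, ι_mul_ι_add_swap, polar_negSq, h, mul_zero, neg_zero, map_zero]

variable {n : ℕ} {S : Type*} [NormedAddCommGroup S] [InnerProductSpace ℝ S]

/-- Pair the Clifford relation `xy + yx = -2⟨x, y⟩`, applied to `s`, with `s`, and move one factor
across by skewness. -/
theorem IsSpinMetric.inner_ι_ι {η : Cl n →ₐ[ℝ] End ℝ S} (hη : IsSpinMetric η) (x y : V n) (s : S) :
    inner ℝ (η (ι (negSq n) x) s) (η (ι (negSq n) y) s) = inner ℝ x y * ‖s‖ ^ 2 := by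
  have h1 := hη.skew x s (η (ι (negSq n) y) s)
  have h2 := hη.skew y s (η (ι (negSq n) x) s)
  have h3 := congr(inner ℝ s (η $(ι_mul_ι_add_swap (Q := negSq n) x y) s))
  rw [polar_negSq, AlgHom.commutes, Module.algebraMap_end_apply, real_inner_smul_right,
    real_inner_self_eq_norm_sq, map_add, map_mul, map_mul, LinearMap.add_apply, inner_add_right,
    End.mul_apply, End.mul_apply] at h3
  rw [real_inner_comm] at h2
  linarith

theorem inner_spinIsometry_sphereToSpin {η : Cl n →ₐ[ℝ] End ℝ S} (hη : IsSpinMetric η)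
    (Sp : Subrepresentation (spinRep η)) (x₀ x y : Metric.sphere (0 : V n) 1)
    (s : Sp.toSubmodule) :
    inner ℝ (spinIsometry hη Sp (sphereToSpin x₀ x) s) (spinIsometry hη Sp (sphereToSpin x₀ y) s) =
      inner ℝ (x : V n) (y : V n) * ‖s‖ ^ 2 := by
  have hx : ‖(x₀ : V n)‖ = 1 := by simp
  change inner ℝ (η (ι (negSq n) x₀ * ι (negSq n) x) (s : S))
    (η (ι (negSq n) x₀ * ι (negSq n) y) (s : S)) = _
  rw [map_mul, map_mul, End.mul_apply, End.mul_apply, hη.orthogonal _ hx, hη.inner_ι_ι]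
  rfl

/-- The elements `b₀ x`, for a fixed unit vector `b₀`, generate the even part of `Cl(n)`: a
subspace that they preserve is preserved by all even elements. -/
theorem map_mem_of_even (η : Cl n →ₐ[ℝ] End ℝ S) (b₀ : Metric.sphere (0 : V n) 1)
    {U : Submodule ℝ S}
    (hU : ∀ x : V n, ∀ s ∈ U, η (ι (negSq n) (b₀ : V n) * ι (negSq n) x) s ∈ U)
    (a : Cl n) (ha : a ∈ evenOdd (negSq n) 0) : ∀ s ∈ U, η a s ∈ U := by
  induction a, ha using even_induction with
  | algebraMap r =>
    intro s hs
    rw [AlgHom.commutes, Module.algebraMap_end_apply]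
    exact U.smul_mem r hs
  | add x y _ _ hx hy =>
    intro s hs
    rw [map_add, LinearMap.add_apply]
    exact U.add_mem (hx s hs) (hy s hs)
  | ι_mul_ι_mul x y a _ ih =>
    intro s hs
    -- Insert `-b₀² = 1` between `x` and `y`, then swap `x` past `b₀`.
    have h1 : ι (negSq n) x * ι (negSq n) y =
        (ι (negSq n) (b₀ : V n) * ι (negSq n) x - algebraMap ℝ _
          (QuadraticMap.polar (negSq n) (b₀ : V n) x)) *
            (ι (negSq n) (b₀ : V n) * ι (negSq n) y) := by
      rw [← ι_mul_ι_add_swap, sub_add_cancel_left, neg_mul, mul_assoc, ← mul_assoc _ _ (ι _ y),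
        unit_sq, neg_one_mul, mul_neg, neg_neg]
    rw [h1, map_mul, map_mul, map_sub, AlgHom.commutes, End.mul_apply, End.mul_apply,
      LinearMap.sub_apply, Module.algebraMap_end_apply]
    have h2 := hU y _ (ih s hs)
    exact U.sub_mem (hU x _ h2) (U.smul_mem _ h2)

/-- An irreducible `Spin(m + 1)`-submodule has dimension `d (m + 1)`. -/
theorem finrank_eq_d {m : ℕ} (η : Cl (m + 1) →ₐ[ℝ] End ℝ S)
    (Sp : Subrepresentation (spinRep η)) (hSp : Sp.toRepresentation.IsIrreducible) :
    FiniteDimensional ℝ Sp.toSubmodule ∧ finrank ℝ Sp.toSubmodule = d (m + 1) := by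
  let b : Fin (m + 1) → Metric.sphere (0 : V (m + 1)) 1 := fun i =>
    ⟨EuclideanSpace.single i 1, by simp⟩
  have hb : ∀ i j, i ≠ j → inner ℝ (b i : V (m + 1)) (b j : V (m + 1)) = 0 := fun i j hij => by
    simp [b, EuclideanSpace.inner_single_left, hij]
  obtain ⟨c, hc⟩ : ∃ c : Fin (m + 1) → Cl (m + 1),
      ∀ i, c i = ι (negSq (m + 1)) (b i : V (m + 1)) := ⟨_, fun _ => rfl⟩
  have hcsq : ∀ i, c i * c i = -1 := fun i => by rw [hc, unit_sq]
  have hcan : ∀ i j, i ≠ j → c i * c j = -(c j * c i) := fun i j hij => by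
    rw [hc, hc, ι_mul_ι_anticomm (hb i j hij)]
  have hprod : ∀ i j, i ≠ 0 → c 0 * c i * (c 0 * c j) = c i * c j := fun i j hi => by
    rw [mul_assoc, ← mul_assoc (c i), hcan i 0 hi, neg_mul, mul_neg, mul_assoc, ← mul_assoc (c 0),
      hcsq, neg_one_mul, neg_neg]
  -- The complex structures `b₀bᵢ₊₁`; the value `0` beyond `m` is only a filler.
  let e : ℕ → End ℝ Sp.toSubmodule := fun i =>
    if h : i < m then Sp.toRepresentation (sphereToSpin (b 0) (b (Fin.succ ⟨i, h⟩))) else 0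
  have he : ∀ i (h : i < m) (s : Sp.toSubmodule),
      (e i s : S) = η (c 0 * c (Fin.succ ⟨i, h⟩)) s := fun i h s => by
    simp only [e, h, dif_pos, hc]
    rfl
  have hs : CliffordSystem m 0 e 0 := by
    refine ⟨fun i hi => ?_, by simp, fun i hi j hj hij => ?_, by simp, by simp⟩
    · ext s
      rw [End.mul_apply, he i hi, he i hi, ← End.mul_apply, ← map_mul,
        hprod _ _ (Fin.succ_ne_zero _), hcsq]
      simp
    · ext s
      rw [End.mul_apply, he i hi, he j hj, ← End.mul_apply, ← map_mul,
        hprod _ _ (Fin.succ_ne_zero _), LinearMap.neg_apply, End.mul_apply, Submodule.coe_neg,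
        he j hj, he i hi, ← End.mul_apply, ← map_mul, hprod _ _ (Fin.succ_ne_zero _),
        hcan _ _ (fun h => hij (by simpa using h)), map_neg, LinearMap.neg_apply]
  have hne : (⊤ : Submodule ℝ Sp.toSubmodule) ≠ ⊥ := fun h =>
    (bot_ne_top (α := Subrepresentation Sp.toRepresentation))
      (Subrepresentation.toSubmodule_injective h.symm)
  obtain ⟨U, -, hU, hUf, hUr⟩ := hasInvariantSubspace_d m _ e 0 hs ⊤ hne ⟨by simp, by simp⟩
  have hUb : ∀ x : V (m + 1), ∀ s ∈ U.map Sp.toSubmodule.subtype,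
      η (ι (negSq (m + 1)) (b 0 : V (m + 1)) * ι (negSq (m + 1)) x) s ∈
        U.map Sp.toSubmodule.subtype := by
    rintro x _ ⟨s, hs, rfl⟩
    have hx : x = ∑ i, x i • (b i : V (m + 1)) := by
      ext j
      simp [b, Pi.single_apply]
    rw [hx, map_sum, Finset.mul_sum, map_sum, LinearMap.sum_apply]
    refine Submodule.sum_mem _ fun i _ => ?_
    rw [map_smul, mul_smul_comm, map_smul, LinearMap.smul_apply]
    refine Submodule.smul_mem _ _ ?_
    rw [← hc, ← hc]
    refine Fin.cases ?_ (fun i => ?_) i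
    · rw [hcsq, map_neg, map_one, LinearMap.neg_apply, End.one_apply]
      exact Submodule.neg_mem _ (Submodule.mem_map_of_mem hs)
    · exact ⟨e i s, hU.1 i i.2 s hs, he i i.2 s⟩
  have hspin : ∀ (g : Spin (m + 1)), ∀ s ∈ U, Sp.toRepresentation g s ∈ U := fun g s hs => by
    obtain ⟨t, ht, hts⟩ := map_mem_of_even η (b 0) hUb (g : Cl (m + 1)) (spinGroup.mem_even g.2) s
      (Submodule.mem_map_of_mem hs)
    obtain rfl : t = Sp.toRepresentation g s := Subtype.ext hts
    exact ht
  have hd : 0 < d (m + 1) := by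
    unfold d
    split <;> positivity
  have htop : U = ⊤ := by
    rcases hSp.eq_bot_or_eq_top ⟨U, hspin⟩ with h | h
    · have h' : U = ⊥ := congrArg Subrepresentation.toSubmodule h
      rw [h', finrank_bot] at hUr
      omega
    · exact congrArg Subrepresentation.toSubmodule h
  subst htop
  rw [finrank_top] at hUr
  exact ⟨FiniteDimensional.of_finrank_pos (hUr ▸ hd), hUr⟩

end Spinors

/-! ### Existence of a transverse sphere -/

section Existence

/-- Doubling: put `A` and `-A` on the diagonal and adjoin the rotation exchanging the two copies.
The size is immaterial, since an invariant subspace of the right dimension is extracted afterwards.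
-/
theorem exists_skew_matrices (m : ℕ) :
    ∃ (κ : Type) (_ : Fintype κ) (_ : DecidableEq κ) (_ : Nonempty κ) (A : ℕ → Matrix κ κ ℝ),
      (∀ i, (A i).transpose = -A i) ∧ (∀ i < m, A i * A i = -1) ∧
        ∀ i < m, ∀ j < m, i ≠ j → A i * A j = -(A j * A i) := by
  induction m with
  | zero => exact ⟨Unit, inferInstance, inferInstance, inferInstance, 0, by simp, by simp, by simp⟩
  | succ m ih =>
    obtain ⟨κ, _, _, _, A, hT, hsq, han⟩ := ih
    refine ⟨κ ⊕ κ, inferInstance, inferInstance, inferInstance, fun i =>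
      if i < m then .fromBlocks (A i) 0 0 (-A i) else .fromBlocks 0 (-1) 1 0, fun i => ?_,
      fun i hi => ?_, fun i hi j hj hij => ?_⟩
    · dsimp only
      split_ifs <;> simp [Matrix.fromBlocks_transpose, Matrix.fromBlocks_neg, hT]
    · dsimp only
      rw [← Matrix.fromBlocks_one, Matrix.fromBlocks_neg]
      split_ifs with h
      · simp [Matrix.fromBlocks_multiply, hsq i h]
      · simp [Matrix.fromBlocks_multiply]
    · dsimp only
      split_ifs with h h' h'
      · simp [Matrix.fromBlocks_multiply, Matrix.fromBlocks_neg, han i h j h' hij]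
      · simp [Matrix.fromBlocks_multiply, Matrix.fromBlocks_neg]
      · simp [Matrix.fromBlocks_multiply, Matrix.fromBlocks_neg]
      · omega

/-- The vectors `s, e₀s, …, eₘ₋₁s` are pairwise orthogonal of length `‖s‖`. -/
theorem inner_of_skew {M : Type*} [NormedAddCommGroup M] [InnerProductSpace ℝ M] {m : ℕ}
    {e : ℕ → End ℝ M} (hskew : ∀ i u v, inner ℝ (e i u) v = -inner ℝ u (e i v))
    (hs : CliffordSystem m 0 e 0) (x y : V (m + 1)) (s : M) :
    inner ℝ (x 0 • s + ∑ i : Fin m, x i.succ • e i s) (y 0 • s + ∑ i : Fin m, y i.succ • e i s) =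
      inner ℝ x y * ‖s‖ ^ 2 := by
  have h0 : ∀ i, inner ℝ s (e i s) = 0 := fun i => by
    have := hskew i s s
    rw [real_inner_comm] at this
    linarith
  have h0' : ∀ i, inner ℝ (e i s) s = 0 := fun i => by rw [real_inner_comm, h0]
  have h1 : ∀ i j : Fin m, inner ℝ (e i s) (e j s) = if i = j then ‖s‖ ^ 2 else 0 := by
    intro i j
    split_ifs with h
    · subst h
      have := congr($(hs.e_sq i i.2) s)
      rw [hskew, show e i (e i s) = -s by simpa using this, inner_neg_right, neg_neg,
        real_inner_self_eq_norm_sq]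
    · have h2 : e i (e j s) = -e j (e i s) := by
        simpa using congr($(hs.e_anti i i.2 j j.2 (fun h' => h (Fin.ext h'))) s)
      have h3 : inner ℝ (e i s) (e j s) = -inner ℝ (e j s) (e i s) := by
        rw [hskew, h2, inner_neg_right, neg_neg, hskew j, neg_neg]
      rw [real_inner_comm (e i s)] at h3
      linarith
  simp only [inner_add_left, inner_add_right, sum_inner, inner_sum, real_inner_smul_left,
    real_inner_smul_right, h0, h0', h1, mul_zero, Finset.sum_const_zero, add_zero, zero_add,
    mul_ite, Finset.sum_ite_eq', Finset.mem_univ, if_true,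
    real_inner_self_eq_norm_sq, PiLp.inner_apply, Fin.sum_univ_succ]
  simp only [RCLike.inner_apply, conj_trivial, add_mul, Finset.sum_mul]
  congr 1
  · ring
  · exact Finset.sum_congr rfl fun i _ => by ring

/-- Orthogonal maps `g x` of the Euclidean space of dimension `d (m + 1)` that satisfy
`⟨g x s, g y s⟩ = ⟨x, y⟩ ‖s‖²`. -/
theorem exists_isometries (m : ℕ) :
    ∃ g : Metric.sphere (0 : V (m + 1)) 1 → V (d (m + 1)) ≃ₗᵢ[ℝ] V (d (m + 1)),
      ∀ x y s, inner ℝ (g x s) (g y s) = inner ℝ (x : V (m + 1)) (y : V (m + 1)) * ‖s‖ ^ 2 := by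
  obtain ⟨κ, _, _, _, A, hT, hsq, han⟩ := exists_skew_matrices m
  set e : ℕ → End ℝ (EuclideanSpace ℝ κ) := fun i => Matrix.toEuclideanLin (A i) with he
  have hmul : ∀ i j, e i * e j = Matrix.toEuclideanLin (A i * A j) := fun i j => by
    ext v k
    simp [he, Matrix.toLpLin_apply]
  have hs : CliffordSystem m 0 e 0 := by
    refine ⟨fun i hi => ?_, by simp, fun i hi j hj hij => ?_, by simp, by simp⟩
    · rw [hmul, hsq i hi]
      ext v k
      simp
    · rw [hmul, hmul, han i hi j hj hij, map_neg]
  have hskew : ∀ i u v, inner ℝ (e i u) v = -inner ℝ u (e i v) := fun i u v => by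
    rw [← LinearMap.adjoint_inner_right, he, ← Matrix.toEuclideanLin_conjTranspose_eq_adjoint,
      Matrix.conjTranspose_eq_transpose_of_trivial, hT, map_neg, LinearMap.neg_apply,
      inner_neg_right]
  obtain ⟨U, -, hU, hUf, hUr⟩ := hasInvariantSubspace_d m _ e 0 hs ⊤ top_ne_bot
    ⟨by simp, by simp⟩
  have hmem : ∀ (x : V (m + 1)), ∀ s ∈ U,
      (x 0 • 1 + ∑ i : Fin m, x i.succ • e i : End ℝ (EuclideanSpace ℝ κ)) s ∈ U := fun x s hs => by
    simp only [LinearMap.add_apply, LinearMap.sum_apply, LinearMap.smul_apply, End.one_apply]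
    exact U.add_mem (U.smul_mem _ hs) (U.sum_mem fun i _ => U.smul_mem _ (hU.1 i i.2 s hs))
  set a : V (m + 1) → U →ₗ[ℝ] U := fun x => LinearMap.restrict _ (hmem x) with ha
  have hinner : ∀ x y s, inner ℝ (a x s) (a y s) = inner ℝ x y * ‖s‖ ^ 2 := fun x y s => by
    have h := inner_of_skew hskew hs x y s
    simpa [ha] using h
  have hnorm : ∀ (x : Metric.sphere (0 : V (m + 1)) 1) (s : U), ‖a x s‖ = ‖s‖ := fun x s => by
    have hx : ‖(x : V (m + 1))‖ = 1 := by simp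
    have := hinner x x s
    rwa [real_inner_self_eq_norm_sq, real_inner_self_eq_norm_sq, hx, one_pow, one_mul,
      sq_eq_sq₀ (norm_nonneg _) (norm_nonneg _)] at this
  let φ : U ≃ₗᵢ[ℝ] V (d (m + 1)) :=
    ((stdOrthonormalBasis ℝ U).reindex (finCongr hUr)).repr
  -- A norm-preserving endomorphism in finite dimension is onto.
  let g : Metric.sphere (0 : V (m + 1)) 1 → U ≃ₗᵢ[ℝ] U := fun x =>
    LinearIsometry.toLinearIsometryEquiv ⟨a x, hnorm x⟩ rfl
  have hg : ∀ x s, g x s = a x s := fun x s => rfl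
  refine ⟨fun x => φ.symm.trans ((g x).trans φ), fun x y s => ?_⟩
  simp only [LinearIsometryEquiv.trans_apply, LinearIsometryEquiv.inner_map_map, hg, hinner,
    LinearIsometryEquiv.norm_map]

theorem nonempty_isoFlag {p q r : ℕ} (hp : r ≤ p) (hq : r ≤ q) : Nonempty (Iso p q r) := by
  -- Pairing the `j`-th basis vectors of the two factors gives mutually orthogonal null vectors;
  -- initial segments span the flag.
  set w : Fin r → Rpq p q := fun j => WithLp.toLp 2
    (EuclideanSpace.single (Fin.castLE hp j) 1, EuclideanSpace.single (Fin.castLE hq j) 1) with hw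
  have hform : ∀ j k, form _ _ (w j) (w k) = 0 := fun j k => by
    rw [form_apply]
    simp [hw, EuclideanSpace.inner_single_left, Fin.ext_iff]
  have hli : LinearIndependent ℝ w := by
    refine LinearIndependent.of_comp (WithLp.fstₗ 2 ℝ _ _) ?_
    have h := (EuclideanSpace.basisFun (Fin p) ℝ).orthonormal.linearIndependent.comp
      (Fin.castLE hp) (Fin.castLE_injective hp)
    have heq : WithLp.fstₗ 2 ℝ (V p) (V q) ∘ w =
        EuclideanSpace.basisFun (Fin p) ℝ ∘ Fin.castLE hp := by
      funext j
      simp [hw]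
    rw [heq]
    exact h
  refine ⟨fun i => Submodule.span ℝ (Set.range (w ∘ Fin.castLE (Nat.succ_le_of_lt i.2))),
    fun i => ?_, fun i j hij => ?_, fun i u hu v hv => ?_⟩
  · rw [finrank_span_eq_card (hli.comp _ (Fin.castLE_injective _)), Fintype.card_fin]
  · refine Submodule.span_mono ?_
    rintro _ ⟨k, rfl⟩
    exact ⟨Fin.castLE (Nat.succ_le_succ hij) k, rfl⟩
  · induction hu, hv using Submodule.span_induction₂ with
    | mem_mem u v hu hv =>
      obtain ⟨j, rfl⟩ := hu
      obtain ⟨k, rfl⟩ := hv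
      exact hform _ _
    | zero_left => simp
    | zero_right => simp
    | add_left x y z _ _ _ h1 h2 => simp [h1, h2]
    | add_right x y z _ _ _ h1 h2 => simp [h1, h2]
    | smul_left c x y _ _ h => simp [h]
    | smul_right c x y _ _ h => simp [h]

/-- Guarantees that flags of length `d n - 1` have at least one member. -/
theorem two_le_d {n : ℕ} (hn : 2 ≤ n) : 2 ≤ d n := by
  by_cases h : (n - 1) / 8 = 0
  · have : n ≤ 8 := by omega
    interval_cases n <;> decide
  · have h1 : 16 ≤ 16 ^ ((n - 1) / 8) := Nat.le_self_pow h 16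
    have h2 : ∀ c, 1 ≤ c → 2 ≤ c * 16 ^ ((n - 1) / 8) := fun c hc => by nlinarith
    unfold d
    split <;> exact h2 _ (by norm_num)

end Existence

end TransverseSpinor

theorem mainTheorem7 (n : ℕ) (hn : 1 ≤ n) :
    (∀ (S : Type*) [NormedAddCommGroup S] [InnerProductSpace ℝ S]
      (η : TransverseSpinor.Cl n →ₐ[ℝ] Module.End ℝ S)
      (_ : (TransverseSpinor.clRep η).IsIrreducible)
      (hη : TransverseSpinor.IsSpinMetric η)
      (Sp : Subrepresentation (TransverseSpinor.spinRep η))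
      (_ : Sp.toRepresentation.IsIrreducible),
      Module.finrank ℝ Sp.toSubmodule = TransverseSpinor.d n ∧
      ∀ (x₀ : Metric.sphere (0 : TransverseSpinor.V n) 1) (p r : ℕ), 1 ≤ p → 1 ≤ r →
        r ≤ min p (TransverseSpinor.d n) →
        ∀ F : TransverseSpinor.IsoFlag (EuclideanSpace ℝ (Fin p)) Sp.toSubmodule r,
          Topology.IsEmbedding (TransverseSpinor.orbitMap hη Sp x₀ F) ∧
          TransverseSpinor.IsoFlag.IsTransverseSphere (n - 1)
            (Set.range (TransverseSpinor.orbitMap hη Sp x₀ F))) ∧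
    (2 ≤ n →
      ∃ Λ : Set (TransverseSpinor.Iso (TransverseSpinor.d n - 1) (TransverseSpinor.d n)
          (TransverseSpinor.d n - 1)),
        TransverseSpinor.IsoFlag.IsTransverseSphere (n - 1) Λ) := by
  obtain ⟨m, rfl⟩ : ∃ m, n = m + 1 := ⟨n - 1, by omega⟩
  refine ⟨fun S _ _ η _ hη Sp hSp => ?_, fun hm => ?_⟩
  · obtain ⟨_, hrank⟩ := TransverseSpinor.finrank_eq_d η Sp hSp
    exact ⟨hrank, fun x₀ p r _ hr _ F => F.isTransverseSphere_range hr
      (TransverseSpinor.inner_spinIsometry_sphereToSpin hη Sp x₀)⟩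
  · obtain ⟨g, hg⟩ := TransverseSpinor.exists_isometries m
    obtain ⟨F⟩ := TransverseSpinor.nonempty_isoFlag (p := TransverseSpinor.d (m + 1) - 1)
      (q := TransverseSpinor.d (m + 1)) le_rfl (Nat.sub_le _ _)
    exact ⟨_, (F.isTransverseSphere_range
      (Nat.le_sub_of_add_le (TransverseSpinor.two_le_d hm)) hg).2⟩
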